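/- Let $d\ge 0$, let $D\subset\mathbb{R}^d$ be a bounded Borel set (for instance a bounded domain) and let $\mathfrak m$ be a Borel probability measure on $\mathbb{R}^d$ that is concentrated on $D$ and absolutely continuous with respect to Lebesgue measure (for instance the uniform measure on $D$ if $D$ has positive measure). For Borel probability measures let $$W_2^2(\mu,\nu)=\inf\Big\{\int |x-y|^2\,d\Sigma(x,y)\ :\ \Sigma \text{ is a coupling of } \mu \text{ and } \nu\Big\},$$ and call a Borel map $T$ with $T_\#\mu=\nu$ optimal from $\mu$ to $\nu$ if $\int |T(x)-x|^2\,d\mu(x)=W_2^2(\mu,\nu)$. Let $n\ge 1$, let $X_1,\dots,X_n,Y_1,\dots,Y_n$ be independent random variables on a probability space $(\Omega,\mathbb P)$, all with law $\mathfrak m$, and let $\mu^n=\frac1n\sum_{i=1}^n\delta_{X_i}$ and $\nu^n=\frac1n\sum_{i=1}^n\delta_{Y_i}$. Then $W_2^2(\mu^n,\nu^n)$ and $W_2^2(\mu^n,\mathfrak m)$ are finite and $\mathbb P$-integrable. There is a jointly measurable map $(\omega,x)\mapsto T^{\mu^n(\omega)}(x)$ such that, for every $\omega$, $T^{\mu^n(\omega)}$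 is an optimal map from $\mathfrak m$ to $\mu^n(\omega)$. Moreover, for every $(\mathbb P\otimes\mathfrak m)$-measurable map $(\omega,x)\mapsto T^{\mu^n(\omega)}(x)$ such that $T^{\mu^n(\omega)}$ is optimal from $\mathfrak m$ to $\mu^n(\omega)$ for $\mathbb P$-almost every $\omega$, the expectation $\mathbb E[T^{\mu^n}(x)-x]$ exists for $\mathfrak m$-a.e. $x$, its squared norm is $\mathfrak m$-integrable, and $$\mathbb E\big[W_2^2(\mu^n,\nu^n)\big]\ \le\ 2\,\mathbb E\big[W_2^2(\mu^n,\mathfrak m)\big]-2\int_D\big|\mathbb E\big[T^{\mu^n}(x)-x\big]\big|^2\,d\mathfrak m(x).$$ -/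

import Mathlib

open MeasureTheory ProbabilityTheory
open scoped ENNReal

noncomputable section

/-- Transport plans (couplings): measures on the product with marginals `μ` and `ν`. -/
def transportPlans {α : Type*} [MeasurableSpace α] (μ ν : Measure α) : Set (Measure (α × α)) :=
  {π | π.map Prod.fst = μ ∧ π.map Prod.snd = ν}

/-- The squared quadratic Wasserstein distance, as an extended nonnegative number. -/
def W2Sq {α : Type*} [PseudoEMetricSpace α] [MeasurableSpace α] (μ ν : Measure α) : ℝ≥0∞ :=
  ⨅ π ∈ transportPlans μ ν, ∫⁻ p, edist p.1 p.2 ^ 2 ∂π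

/-- `T` is an optimal transport map from `μ` to `ν`: a Borel map that pushes `μ` to `ν` and
whose quadratic cost is the squared Wasserstein distance. -/
def IsOptimalMap {α : Type*} [PseudoEMetricSpace α] [MeasurableSpace α] (μ ν : Measure α)
    (T : α → α) : Prop :=
  Measurable T ∧ μ.map T = ν ∧ ∫⁻ x, edist (T x) x ^ 2 ∂μ = W2Sq μ ν

/-- The empirical measure `(1/n) ∑ δ_{x i}` of `n` points. -/
def empiricalMeasure {α : Type*} [MeasurableSpace α] {n : ℕ} (x : Fin n → α) : Measure α :=
  (n : ℝ≥0∞)⁻¹ • ∑ i, Measure.dirac (x i)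

end

/-! Write `T ω` for an optimal map from `m` to the empirical measure of `X · ω`. For two outcomes
`ω`, `ω'`, pushing `m` forward by `(T ω, T ω')` couples the two empirical measures, so their squared
distance is at most `∫ |T ω z - T ω' z|² dm`. The samples `(X, Y)` have the joint law of `(X ω, X
ω')` under `P ⊗ P` (`map_prodMk_eq_map_prod`). Averaging and exchanging integrals leaves, at each
`z`, twice the variance of the displacement `T ω z - z` (`lintegral_lintegral_edist_sq`). Its second
moment integrates to the expected cost `E W₂²(μⁿ, m)`, and its squared mean is the subtracted term.

Optimal maps come from semidiscrete duality. At a maximizer of `semidiscreteDual`, the first-order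
condition gives the Laguerre cells enough mass (`card_div_le_measureReal_of_forall_le`), ties are
null by absolute continuity, and the potentials certify optimality (`isOptimalMap_nearest`).
Measurability in the points follows by selecting both the weights and the nearest index with
`exists_measurable_argmax`. -/

set_option linter.unusedSectionVars false

/-! ### Measurable selection of maximizers -/

/-- A jointly continuous real function on `X × U`, `U` compact and metrizable, has a maximizer in
the second variable which depends measurably on the first one. -/
theorem exists_measurable_argmax {X U : Type*} [TopologicalSpace X] [MeasurableSpace X]
    [BorelSpace X] [TopologicalSpace U] [TopologicalSpace.MetrizableSpace U] [CompactSpace U] [Nonempty U]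
    [MeasurableSpace U] [BorelSpace U] {F : X → U → ℝ} (hF : Continuous (Function.uncurry F)) :
    ∃ s : X → U, Measurable s ∧ ∀ x u, F x u ≤ F x (s x) := by
  let := TopologicalSpace.metrizableSpaceMetric U
  -- Pulling `U` back to the Cantor set provides a linear order, so that the least maximizer is a
  -- canonical choice.
  obtain ⟨g, hg, hgs⟩ := exists_nat_bool_continuous_surjective_of_compact U
  have : CompactSpace cantorSet := isCompact_iff_compactSpace.1 isCompact_cantorSet
  set q : cantorSet → U := fun c => g (cantorSetHomeomorphNatToBool c) with hq
  have hqc : Continuous q := hg.comp cantorSetHomeomorphNatToBool.continuous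
  have hqs : Function.Surjective q := hgs.comp cantorSetHomeomorphNatToBool.surjective
  have : Nonempty cantorSet := ⟨⟨0, zero_mem_cantorSet⟩⟩
  have hFq : Continuous fun p : X × cantorSet => F p.1 (q p.2) := by
    exact hF.comp (continuous_fst.prodMk (hqc.comp continuous_snd))
  set M : Set (X × cantorSet) := {p | ∀ u, F p.1 u ≤ F p.1 (q p.2)} with hM
  have hMc : IsClosed M := by
    simp only [hM, Set.ofPred_forall]
    exact isClosed_iInter fun u =>
      isClosed_le (hF.comp (continuous_fst.prodMk continuous_const)) hFq
  have hleast : ∀ x, ∃ c, IsLeast {c | (x, c) ∈ M} c := by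
    intro x
    apply IsCompact.exists_isLeast
    · exact (hMc.preimage (Continuous.prodMk_right x)).isCompact
    · obtain ⟨c, -, hc⟩ := isCompact_univ.exists_isMaxOn Set.univ_nonempty
        (f := fun c => F x (q c)) (hFq.comp (Continuous.prodMk_right x)).continuousOn
      refine ⟨c, fun u => ?_⟩
      obtain ⟨c', rfl⟩ := hqs u
      exact hc (Set.mem_univ c')
  choose c hc using hleast
  refine ⟨fun x => q (c x), hqc.measurable.comp ?_, fun x u => (hc x).1 u⟩
  refine Measurable.subtype_mk (f := fun x => (c x : ℝ)) (measurable_of_Iic fun a => ?_)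
  -- The least maximizer is at most `a` iff some maximizer is; this is a projection of a closed set
  -- along a compact factor, hence closed.
  have : (fun x => (c x : ℝ)) ⁻¹' Set.Iic a = Prod.fst '' (M ∩ {p | (p.2 : ℝ) ≤ a}) := by
    ext x
    constructor
    · intro h
      exact ⟨(x, c x), ⟨(hc x).1, h⟩, rfl⟩
    · rintro ⟨⟨x, c'⟩, ⟨h1, h2⟩, rfl⟩
      exact le_trans (Subtype.coe_le_coe.2 ((hc x).2 h1)) h2
  rw [this]
  refine (isClosedMap_fst_of_compactSpace _ (hMc.inter ?_)).measurableSet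
  exact isClosed_le (continuous_subtype_val.comp continuous_snd) continuous_const

/-! ### Couplings and the distance between empirical measures -/

section Wasserstein

variable {α β : Type*} [MeasurableSpace α] [MeasurableSpace β]

theorem map_prodMk_mem_transportPlans {m : Measure β} {S T : β → α} (hS : Measurable S)
    (hT : Measurable T) : m.map (fun x => (S x, T x)) ∈ transportPlans (m.map S) (m.map T) := by
  constructor <;> rw [Measure.map_map (by fun_prop) (by fun_prop)] <;> rfl

theorem map_swap_mem_transportPlans {μ ν : Measure α} {π : Measure (α × α)}
    (h : π ∈ transportPlans μ ν) : π.map Prod.swap ∈ transportPlans ν μ := by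
  constructor
  · rw [Measure.map_map (by fun_prop) (by fun_prop)]; exact h.2
  · rw [Measure.map_map (by fun_prop) (by fun_prop)]; exact h.1

theorem isProbabilityMeasure_of_mem_transportPlans {μ ν : Measure α} [IsProbabilityMeasure μ]
    {π : Measure (α × α)} (h : π ∈ transportPlans μ ν) : IsProbabilityMeasure π := by
  have : IsProbabilityMeasure (π.map Prod.fst) := by rw [h.1]; infer_instance
  exact Measure.isProbabilityMeasure_of_map Prod.fst

theorem W2Sq_le_lintegral [PseudoEMetricSpace α] [OpensMeasurableSpace α]
    [SecondCountableTopology α] (m : Measure β) {S T : β → α}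
    (hS : Measurable S) (hT : Measurable T) :
    W2Sq (m.map S) (m.map T) ≤ ∫⁻ x, edist (S x) (T x) ^ 2 ∂m := by
  refine (iInf₂_le _ (map_prodMk_mem_transportPlans hS hT)).trans_eq ?_
  rw [lintegral_map (by fun_prop) (by fun_prop)]

theorem W2Sq_comm [PseudoEMetricSpace α] [OpensMeasurableSpace α]
    [SecondCountableTopology α] (μ ν : Measure α) : W2Sq μ ν = W2Sq ν μ := by
  have key : ∀ μ ν : Measure α, W2Sq μ ν ≤ W2Sq ν μ := by
    refine fun μ ν => le_iInf₂ fun π hπ => (iInf₂_le _ (map_swap_mem_transportPlans hπ)).trans_eq ?_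
    rw [lintegral_map (by fun_prop) (by fun_prop)]
    simp [edist_comm]
  exact le_antisymm (key _ _) (key _ _)

variable {n : ℕ}

instance isProbabilityMeasure_empiricalMeasure [NeZero n] (x : Fin n → α) :
    IsProbabilityMeasure (empiricalMeasure x) := by
  constructor
  simp [empiricalMeasure, ENNReal.inv_mul_cancel, NeZero.ne n]

theorem empiricalMeasure_eq_map (x : Fin n → α) :
    empiricalMeasure x = (empiricalMeasure (id : Fin n → Fin n)).map x := by
  have hx : Measurable x := measurable_of_finite x
  simp only [empiricalMeasure, Measure.map_smul, id]
  congr 1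
  rw [← Measure.mapₗ_apply_of_measurable hx, map_sum]
  simp [Measure.mapₗ_apply_of_measurable hx, Measure.map_dirac' hx]

/-- A measure whose first marginal is the image of a probability measure `u` under `f` lifts to a
measure with first marginal `u`. -/
theorem exists_lift_fst {ι γ : Type*} [MeasurableSpace ι] [StandardBorelSpace ι] [Nonempty ι]
    [MeasurableSpace γ] [MeasurableEq α]
    (u : Measure ι) [IsProbabilityMeasure u] {f : ι → α} (hf : Measurable f)
    (π : Measure (α × γ)) [IsProbabilityMeasure π] (hπ : π.map Prod.fst = u.map f) :
    ∃ ρ : Measure (ι × γ), ρ.map Prod.fst = u ∧ ρ.map (Prod.map f id) = π := by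
  -- `κ` disintegrates `u` over the values of `f`. Running it from the first coordinate of `π` glues
  -- `π` and `u` along `α`; the lift then forgets `α`.
  set κ := condDistrib id f u
  have h1 : (u.map f) ⊗ₘ κ = u.map fun i => (f i, i) :=
    compProd_map_condDistrib aemeasurable_id
  set θ : Measure ((α × γ) × ι) := π ⊗ₘ (κ.comap Prod.fst measurable_fst) with hθ
  have hfst : θ.map Prod.fst = π := Measure.fst_compProd _ _
  have h2 : θ.map (fun p => (p.1.1, p.2)) = u.map fun i => (f i, i) := by
    rw [← h1, ← hπ]
    ext s hs
    rw [Measure.map_apply (by fun_prop) hs, Measure.compProd_apply (hs.preimage (by fun_prop)),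
      Measure.compProd_apply hs, lintegral_map (Kernel.measurable_kernel_prodMk_left hs) (by fun_prop)]
    rfl
  have hae : ∀ᵐ p ∂θ, p.1.1 = f p.2 := by
    have : ∀ᵐ p ∂(u.map fun i => (f i, i)), p.1 = f p.2 := by
      rw [ae_map_iff (by fun_prop) (measurableSet_eq_fun (by fun_prop) (by fun_prop))]
      simp
    rw [← h2] at this
    exact ae_of_ae_map (by fun_prop) this
  refine ⟨θ.map fun p => (p.2, p.1.2), ?_, ?_⟩
  · rw [Measure.map_map (by fun_prop) (by fun_prop)]
    calc θ.map (Prod.fst ∘ fun p => (p.2, p.1.2))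
        = (θ.map (fun p => (p.1.1, p.2))).map Prod.snd := by
          rw [Measure.map_map (by fun_prop) (by fun_prop)]; rfl
      _ = u := by
          rw [h2, Measure.map_map (by fun_prop) (by fun_prop)]
          exact Measure.map_id
  · rw [Measure.map_map (by fun_prop) (by fun_prop)]
    conv_rhs => rw [← hfst]
    refine Measure.map_congr ?_
    filter_upwards [hae] with p hp
    simp [← hp]

/-- Couplings lift to the index set one coordinate at a time by `exists_lift_fst`, even when points
coincide. The gain is an infimum over plans that no longer depend on `x` and `y`. -/
theorem W2Sq_empiricalMeasure_eq [PseudoEMetricSpace α] [OpensMeasurableSpace α]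
    [SecondCountableTopology α] [MeasurableEq α] [NeZero n] (x y : Fin n → α) :
    W2Sq (empiricalMeasure x) (empiricalMeasure y) =
      ⨅ π ∈ transportPlans (empiricalMeasure (id : Fin n → Fin n)) (empiricalMeasure id),
        ∫⁻ p, edist (x p.1) (y p.2) ^ 2 ∂π := by
  have hx : Measurable x := measurable_of_finite x
  have hy : Measurable y := measurable_of_finite y
  apply le_antisymm
  · refine le_iInf₂ fun π hπ => ?_
    have h1 : empiricalMeasure x = π.map (x ∘ Prod.fst) := by
      rw [← Measure.map_map hx measurable_fst, hπ.1, ← empiricalMeasure_eq_map]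
    have h2 : empiricalMeasure y = π.map (y ∘ Prod.snd) := by
      rw [← Measure.map_map hy measurable_snd, hπ.2, ← empiricalMeasure_eq_map]
    rw [h1, h2]
    exact W2Sq_le_lintegral π (by fun_prop) (by fun_prop)
  · refine le_iInf₂ fun π hπ => ?_
    have := isProbabilityMeasure_of_mem_transportPlans hπ
    obtain ⟨ρ, hρ1, hρ2⟩ := exists_lift_fst (empiricalMeasure (id : Fin n → Fin n)) hx π
      (by rw [hπ.1, empiricalMeasure_eq_map])
    have : IsProbabilityMeasure (ρ.map (Prod.map x (id : α → α))) := by rw [hρ2]; infer_instance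
    have : IsProbabilityMeasure ρ := Measure.isProbabilityMeasure_of_map (Prod.map x id)
    have : IsProbabilityMeasure (ρ.map Prod.swap) :=
      Measure.isProbabilityMeasure_map (by fun_prop)
    obtain ⟨σ, hσ1, hσ2⟩ := exists_lift_fst (empiricalMeasure (id : Fin n → Fin n)) hy
      (ρ.map Prod.swap) (by
        rw [← empiricalMeasure_eq_map, ← hπ.2, ← hρ2, Measure.map_map (by fun_prop) (by fun_prop),
          Measure.map_map (by fun_prop) (by fun_prop)]
        rfl)
    have hmem : σ.map Prod.swap ∈
        transportPlans (empiricalMeasure (id : Fin n → Fin n)) (empiricalMeasure id) := by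
      constructor
      · rw [Measure.map_map (by fun_prop) (by fun_prop), ← hρ1]
        have : ρ.map Prod.fst = (ρ.map Prod.swap).map Prod.snd := by
          rw [Measure.map_map (by fun_prop) (by fun_prop)]; rfl
        rw [this, ← hσ2, Measure.map_map (by fun_prop) (by fun_prop)]
        rfl
      · rw [Measure.map_map (by fun_prop) (by fun_prop), ← hσ1]
        rfl
    refine (iInf₂_le _ hmem).trans_eq ?_
    have hπσ : π = σ.map (fun p => (x p.2, y p.1)) := by
      have : ρ = (ρ.map Prod.swap).map Prod.swap := by
        rw [Measure.map_map (by fun_prop) (by fun_prop), Prod.swap_swap_eq, Measure.map_id]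
      rw [← hρ2, this, ← hσ2, Measure.map_map (by fun_prop) (by fun_prop),
        Measure.map_map (by fun_prop) (by fun_prop)]
      rfl
    rw [hπσ, lintegral_map (by fun_prop) (by fun_prop), lintegral_map (by fun_prop) (by fun_prop)]
    rfl

/-- For a fixed plan on indices the cost is a finite sum, continuous in the points; an infimum of
such functions is upper semicontinuous. -/
theorem measurable_W2Sq_empiricalMeasure [PseudoEMetricSpace α] [BorelSpace α]
    [SecondCountableTopology α] [MeasurableEq α] [NeZero n] :
    Measurable fun p : (Fin n → α) × (Fin n → α) =>
      W2Sq (empiricalMeasure p.1) (empiricalMeasure p.2) := by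
  simp only [W2Sq_empiricalMeasure_eq]
  apply UpperSemicontinuous.measurable
  refine upperSemicontinuous_biInf fun π hπ => Continuous.upperSemicontinuous ?_
  have := isProbabilityMeasure_of_mem_transportPlans hπ
  simp only [lintegral_fintype]
  refine continuous_finsetSum _ fun i _ => ?_
  refine (ENNReal.continuous_mul_const (measure_ne_top _ _)).comp ?_
  refine (ENNReal.continuous_pow 2).comp ?_
  exact ((continuous_apply _).comp continuous_fst).edist ((continuous_apply _).comp continuous_snd)

end Wasserstein

/-! ### Semidiscrete dual problem and Laguerre cells -/

section Semidiscrete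

variable {E : Type*} [NormedAddCommGroup E] [InnerProductSpace ℝ E] {n : ℕ} [NeZero n]

/-- The Kantorovich potential `z ↦ min_i (|x i - z|² - w i)` of points `x i` with weights `w i`. -/
noncomputable def laguerrePotential (x : Fin n → E) (w : Fin n → ℝ) (z : E) : ℝ :=
  Finset.univ.inf' Finset.univ_nonempty fun i => ‖x i - z‖ ^ 2 - w i

theorem laguerrePotential_le (x : Fin n → E) (w : Fin n → ℝ) (z : E) (i : Fin n) :
    laguerrePotential x w z ≤ ‖x i - z‖ ^ 2 - w i :=
  Finset.inf'_le _ (Finset.mem_univ i)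

theorem le_laguerrePotential {x : Fin n → E} {w : Fin n → ℝ} {z : E} {a : ℝ}
    (h : ∀ i, a ≤ ‖x i - z‖ ^ 2 - w i) : a ≤ laguerrePotential x w z :=
  Finset.le_inf' _ _ fun i _ => h i

theorem laguerrePotential_sub_const (x : Fin n → E) (w : Fin n → ℝ) (c : ℝ) (z : E) :
    laguerrePotential x (fun i => w i - c) z = laguerrePotential x w z + c := by
  apply le_antisymm
  · rw [← sub_le_iff_le_add]
    exact le_laguerrePotential fun i => by
      linarith [laguerrePotential_le x (fun i => w i - c) z i]
  · exact le_laguerrePotential fun i => by linarith [laguerrePotential_le x w z i]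

theorem continuous_laguerrePotential :
    Continuous fun p : ((Fin n → E) × (Fin n → ℝ)) × E => laguerrePotential p.1.1 p.1.2 p.2 := by
  unfold laguerrePotential
  refine Continuous.finset_inf'_apply _ fun i _ => ?_
  fun_prop

theorem continuous_laguerrePotential_right (x : Fin n → E) (w : Fin n → ℝ) :
    Continuous (laguerrePotential x w) := by
  unfold laguerrePotential
  exact Continuous.finset_inf'_apply _ fun i _ => by fun_prop

attribute [irreducible] laguerrePotential

variable [MeasurableSpace E]

/-- The dual functional of the transport of `m` to the empirical measure of `x`. -/
noncomputable def semidiscreteDual (m : Measure E) (x : Fin n → E) (w : Fin n → ℝ) : ℝ :=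
  ∫ z, laguerrePotential x w z ∂m + (∑ i, w i) / n

variable [FiniteDimensional ℝ E] [BorelSpace E] {m : Measure E} [IsProbabilityMeasure m] {r : ℝ}

theorem restrict_closedBall_eq_self (hm : ∀ᵐ z ∂m, ‖z‖ ≤ r) :
    m.restrict (Metric.closedBall 0 r) = m := by
  rw [Measure.restrict_eq_self_of_ae_mem]
  simpa using hm

theorem integrable_of_continuous (hm : ∀ᵐ z ∂m, ‖z‖ ≤ r) {f : E → ℝ} (hf : Continuous f) :
    Integrable f m := by
  rw [← restrict_closedBall_eq_self hm]
  exact hf.continuousOn.integrableOn_compact (isCompact_closedBall 0 r)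

theorem continuous_semidiscreteDual (hm : ∀ᵐ z ∂m, ‖z‖ ≤ r) :
    Continuous fun p : (Fin n → E) × (Fin n → ℝ) => semidiscreteDual m p.1 p.2 := by
  unfold semidiscreteDual
  refine Continuous.add ?_ (by fun_prop)
  have := continuous_parametric_integral_of_continuous (μ := m)
    (f := fun (p : (Fin n → E) × (Fin n → ℝ)) z => laguerrePotential p.1 p.2 z)
    continuous_laguerrePotential (isCompact_closedBall (0 : E) r)
  simpa only [restrict_closedBall_eq_self hm] using this

/-- The two shifts cancel because both marginals have mass one. This allows the largest weight to be
normalized to `0`. -/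
theorem semidiscreteDual_sub_const (hm : ∀ᵐ z ∂m, ‖z‖ ≤ r) (x : Fin n → E) (w : Fin n → ℝ)
    (c : ℝ) : semidiscreteDual m x (fun i => w i - c) = semidiscreteDual m x w := by
  have hn : (n : ℝ) ≠ 0 := NeZero.ne _
  simp only [semidiscreteDual, laguerrePotential_sub_const]
  rw [integral_add (integrable_of_continuous hm (continuous_laguerrePotential_right x w))
    (integrable_const c)]
  simp only [integral_const, probReal_univ, smul_eq_mul, Finset.sum_sub_distrib, Finset.sum_const,
    Finset.card_univ, Fintype.card_fin, nsmul_eq_mul]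
  field_simp
  ring

/-- Dual maximizers exist, and can be chosen measurably in the points. -/
theorem exists_measurable_semidiscreteDual_argmax (hm : ∀ᵐ z ∂m, ‖z‖ ≤ r) :
    ∃ w : (Fin n → E) → Fin n → ℝ, Measurable w ∧
      ∀ x v, semidiscreteDual m x v ≤ semidiscreteDual m x (w x) := by
  have hn : (0 : ℝ) < n := Nat.cast_pos.2 (NeZero.pos n)
  -- `C x` bounds every `‖x i - z‖ ^ 2` for almost every `z`. After normalization only weights in
  -- `[-n * C x, 0]` compete, so the cube `[0, 1]ⁿ`, rescaled by `W`, is a compact parameter space.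
  set C : (Fin n → E) → ℝ := fun x => ∑ i, (‖x i‖ + r) ^ 2 with hC
  have hC0 : ∀ x, 0 ≤ C x := fun x => Finset.sum_nonneg fun i _ => sq_nonneg _
  set W : (Fin n → E) × (Fin n → Set.Icc (0 : ℝ) 1) → (Fin n → ℝ) :=
    fun p i => -(n * C p.1) * p.2 i with hW
  have hWc : Continuous W := by fun_prop
  obtain ⟨s, hs, hmax⟩ := exists_measurable_argmax (X := Fin n → E)
    (U := Fin n → Set.Icc (0 : ℝ) 1) (F := fun x u => semidiscreteDual m x (W (x, u)))
    ((continuous_semidiscreteDual hm).comp (continuous_fst.prodMk hWc))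
  refine ⟨fun x => W (x, s x), hWc.measurable.comp (measurable_id.prodMk hs), fun x v => ?_⟩
  obtain ⟨i₀, hi₀⟩ := Finite.exists_max v
  rw [← semidiscreteDual_sub_const hm x v (v i₀)]
  set v' : Fin n → ℝ := fun i => v i - v i₀ with hv'
  have hv0 : ∀ i, v' i ≤ 0 := fun i => sub_nonpos.2 (hi₀ i)
  have hv₀ : v' i₀ = 0 := sub_self _
  by_cases hcase : ∀ i, -(n * C x) ≤ v' i
  · have hu : ∀ i, ∃ u : Set.Icc (0 : ℝ) 1, -(n * C x) * u = v' i := by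
      intro i
      rcases (hC0 x).eq_or_lt with h0 | hpos
      · exact ⟨0, by have := hcase i; have := hv0 i; rw [← h0] at *; simp at *; linarith⟩
      · have hp : 0 < n * C x := mul_pos hn hpos
        refine ⟨⟨-v' i / (n * C x), div_nonneg (by linarith [hv0 i]) hp.le, ?_⟩, ?_⟩
        · rw [div_le_one hp]; linarith [hcase i]
        · simp only; field_simp
    choose u hu using hu
    have : v' = W (x, u) := funext fun i => (hu i).symm
    rw [this]
    exact hmax x u
  · push Not at hcase
    obtain ⟨j, hj⟩ := hcase
    -- A weight below `-n * C x` loses to zero weights: its mean is below `-C x`, while the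
    -- potential integrates to at most `C x` since `v' i₀ = 0`.
    refine le_trans ?_ (hmax x fun _ => 0)
    have h1 : semidiscreteDual m x v' ≤ 0 := by
      have hint : ∫ z, laguerrePotential x v' z ∂m ≤ C x := by
        calc ∫ z, laguerrePotential x v' z ∂m ≤ ∫ _, C x ∂m := by
              refine integral_mono_ae (integrable_of_continuous hm
                (continuous_laguerrePotential_right x v')) (integrable_const _) ?_
              filter_upwards [hm] with z hz
              refine (laguerrePotential_le x v' z i₀).trans ?_
              rw [hv₀, sub_zero]
              refine le_trans ?_ (Finset.single_le_sum (f := fun i => (‖x i‖ + r) ^ 2)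
                (fun i _ => sq_nonneg _) (Finset.mem_univ i₀))
              exact pow_le_pow_left₀ (norm_nonneg _) ((norm_sub_le _ _).trans (by linarith)) 2
          _ = C x := by simp
      have hsum : ∑ i, v' i ≤ -(n * C x) := by
        rw [← Finset.add_sum_erase _ v' (Finset.mem_univ j)]
        linarith [Finset.sum_nonpos fun i (_ : i ∈ Finset.univ.erase j) => hv0 i]
      have : (∑ i, v' i) / n ≤ -C x := by
        rw [div_le_iff₀ hn]; linarith
      unfold semidiscreteDual
      linarith
    have h2 : 0 ≤ semidiscreteDual m x (W (x, fun _ => 0)) := by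
      have : W (x, fun _ => 0) = fun _ => 0 := by ext i; simp [hW]
      rw [this]
      unfold semidiscreteDual
      simp only [Finset.sum_const_zero, zero_div, add_zero]
      exact integral_nonneg fun z => le_laguerrePotential fun i => by simp
    exact h1.trans h2

/-- First-order condition at a maximizer. Raising the weights on `A` by `t` gains `t * A.card / n`
and lowers the potential by at most `t`, only where some index of `A` is within `t` of minimal. That
region thus has mass at least `A.card / n`; let `t → 0`. Sets of indices are needed since cells of
coincident points overlap, so bounds for single indices cannot be added. -/
theorem card_div_le_measureReal_of_forall_le (hm : ∀ᵐ z ∂m, ‖z‖ ≤ r) {x : Fin n → E}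
    {w : Fin n → ℝ} (hw : ∀ v, semidiscreteDual m x v ≤ semidiscreteDual m x w)
    (A : Finset (Fin n)) :
    (A.card : ℝ) / n ≤ m.real {z | ∃ i ∈ A, ∀ j, ‖x i - z‖ ^ 2 - w i ≤ ‖x j - z‖ ^ 2 - w j} := by
  classical
  rcases A.eq_empty_or_nonempty with rfl | hA
  · simp
  set g : E → ℝ := fun z => A.inf' hA (fun i => ‖x i - z‖ ^ 2 - w i) - laguerrePotential x w z
    with hg
  have hgc : Continuous g := by
    refine Continuous.sub ?_ (continuous_laguerrePotential_right x w)
    exact Continuous.finset_inf'_apply _ fun i _ => by fun_prop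
  have hS : ∀ t : ℝ, 0 < t → (A.card : ℝ) / n ≤ m.real {z | g z ≤ t} := by
    intro t ht
    set S : Set E := {z | g z ≤ t} with hSdef
    have hmeas : MeasurableSet S := (isClosed_le hgc continuous_const).measurableSet
    have hpt : ∀ z, laguerrePotential x w z - S.indicator (fun _ => t) z ≤
        laguerrePotential x (fun i => w i + if i ∈ A then t else 0) z := by
      intro z
      refine le_laguerrePotential fun i => ?_
      have h1 := laguerrePotential_le x w z i
      by_cases hz : g z ≤ t
      · rw [Set.indicator_of_mem (show z ∈ S from hz)]
        split_ifs <;> linarith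
      · rw [Set.indicator_of_notMem (show z ∉ S from hz)]
        split_ifs with hi
        · have h2 : A.inf' hA (fun i => ‖x i - z‖ ^ 2 - w i) ≤ ‖x i - z‖ ^ 2 - w i :=
            Finset.inf'_le _ hi
          have h3 : t < g z := not_le.1 hz
          simp only [hg] at h3
          linarith
        · linarith
    have hL := integrable_of_continuous hm (continuous_laguerrePotential_right x w)
    have hI : Integrable (S.indicator fun _ => t) m :=
      (integrable_const t).indicator hmeas
    have hint := integral_mono (hL.sub hI) (integrable_of_continuous hm
      (continuous_laguerrePotential_right x (fun i => w i + if i ∈ A then t else 0))) hpt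
    simp only [Pi.sub_apply] at hint
    rw [integral_sub hL hI, integral_indicator_const _ hmeas] at hint
    have := hw (fun i => w i + if i ∈ A then t else 0)
    simp only [semidiscreteDual, Finset.sum_add_distrib, Finset.sum_ite_mem, Finset.univ_inter,
      Finset.sum_const, nsmul_eq_mul, add_div, smul_eq_mul] at this hint
    have h4 : t * (A.card / n) ≤ t * m.real S := by
      have : (A.card : ℝ) * t / n = t * (A.card / n) := by ring
      linarith
    exact le_of_mul_le_mul_left h4 ht
  have hset : {z | ∃ i ∈ A, ∀ j, ‖x i - z‖ ^ 2 - w i ≤ ‖x j - z‖ ^ 2 - w j} =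
      ⋂ k : ℕ, {z | g z ≤ 1 / ((k : ℝ) + 1)} := by
    ext z
    simp only [Set.mem_ofPred_eq, Set.mem_iInter]
    constructor
    · rintro ⟨i, hi, h⟩ k
      have h2 : A.inf' hA (fun i => ‖x i - z‖ ^ 2 - w i) ≤ ‖x i - z‖ ^ 2 - w i :=
        Finset.inf'_le _ hi
      have h3 := le_laguerrePotential h
      have : (0 : ℝ) ≤ 1 / ((k : ℝ) + 1) := by positivity
      simp only [hg]
      linarith
    · intro h
      have h0 : g z ≤ 0 := ge_of_tendsto' tendsto_one_div_add_atTop_nhds_zero_nat h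
      obtain ⟨i, hi, hi'⟩ := A.exists_mem_eq_inf' hA (fun i => ‖x i - z‖ ^ 2 - w i)
      simp only [hg] at h0
      exact ⟨i, hi, fun j => by linarith [laguerrePotential_le x w z j]⟩
  rw [hset]
  have hlim : Filter.Tendsto (fun k : ℕ => m.real {z | g z ≤ 1 / ((k : ℝ) + 1)}) Filter.atTop
      (nhds (m.real (⋂ k : ℕ, {z | g z ≤ 1 / ((k : ℝ) + 1)}))) := by
    refine (ENNReal.tendsto_toReal (measure_ne_top _ _)).comp
      (tendsto_measure_iInter_atTop (fun k => ?_) ?_ ⟨0, measure_ne_top _ _⟩)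
    · exact (isClosed_le hgc continuous_const).measurableSet.nullMeasurableSet
    · intro a b hab z hz
      have hz' : g z ≤ 1 / ((b : ℝ) + 1) := hz
      exact hz'.trans (one_div_le_one_div_of_le (by positivity) (by gcongr))
  exact ge_of_tendsto' hlim fun k => hS _ (by positivity)

/-- The terms `‖z‖ ^ 2` cancel, leaving an affine hyperplane orthogonal to `a - b`, or nothing. -/
theorem addHaar_setOf_norm_sub_sq_eq (μ : Measure E) [μ.IsAddHaarMeasure] {a b : E} (hab : a ≠ b)
    (s t : ℝ) : μ {z | ‖a - z‖ ^ 2 - s = ‖b - z‖ ^ 2 - t} = 0 := by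
  rcases Set.eq_empty_or_nonempty {z | ‖a - z‖ ^ 2 - s = ‖b - z‖ ^ 2 - t} with h | ⟨p, hp⟩
  · rw [h, measure_empty]
  set V := (Submodule.span ℝ {a - b})ᗮ
  refine measure_mono_null (t := (AffineSubspace.mk' p V : Set E)) (fun z hz => ?_)
    (Measure.addHaar_affineSubspace _ _ ?_)
  · rw [SetLike.mem_coe, AffineSubspace.mem_mk', Submodule.mem_orthogonal_singleton_iff_inner_right]
    simp only [Set.mem_ofPred_eq, norm_sub_sq_real] at hp hz
    simp only [vsub_eq_sub, inner_sub_left, inner_sub_right]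
    linarith
  · intro h
    have h1 : V = ⊤ := by
      rw [← AffineSubspace.direction_mk' p V, h, AffineSubspace.direction_top]
    have h2 : a - b ∈ V := by rw [h1]; trivial
    rw [Submodule.mem_orthogonal_singleton_iff_inner_right, inner_self_eq_zero, sub_eq_zero] at h2
    exact hab h2

theorem empiricalMeasure_apply {α : Type*} [MeasurableSpace α] (x : Fin n → α) {B : Set α}
    (hB : MeasurableSet B) [DecidablePred (· ∈ B)] :
    empiricalMeasure x B = ((Finset.univ.filter fun i => x i ∈ B).card : ℝ≥0∞) / n := by
  simp [empiricalMeasure, hB, Set.indicator_apply, ENNReal.div_eq_inv_mul]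

end Semidiscrete

/-! ### Optimal maps to empirical measures -/

section OptimalMaps

variable {E : Type*} [NormedAddCommGroup E] [InnerProductSpace ℝ E] {n : ℕ} [NeZero n]
  [MeasurableSpace E] [FiniteDimensional ℝ E] [BorelSpace E]
  {m : Measure E} [IsProbabilityMeasure m] {r : ℝ}

theorem ae_map_empiricalMeasure_mem {α : Type*} [MeasurableSpace α] [MeasurableSingletonClass α]
    (x : Fin n → α) : ∀ᵐ y ∂empiricalMeasure x, y ∈ Set.range x := by
  rw [empiricalMeasure_eq_map, ae_map_iff (p := (· ∈ Set.range x))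
    (measurable_of_finite x).aemeasurable (Set.finite_range x).measurableSet]
  simp

/-- For dual-optimal weights, a map to a nearest point in the weighted sense pushes an absolutely
continuous measure to the empirical measure. -/
theorem map_nearest_eq_empiricalMeasure {μ : Measure E} [μ.IsAddHaarMeasure] (hac : m ≪ μ)
    (hm : ∀ᵐ z ∂m, ‖z‖ ≤ r) {x : Fin n → E} {w : Fin n → ℝ}
    (hw : ∀ v, semidiscreteDual m x v ≤ semidiscreteDual m x w) {k : E → Fin n}
    (hkm : Measurable k) (hk : ∀ z j, ‖x (k z) - z‖ ^ 2 - w (k z) ≤ ‖x j - z‖ ^ 2 - w j) :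
    m.map (fun z => x (k z)) = empiricalMeasure x := by
  classical
  have hn : (n : ℝ) ≠ 0 := NeZero.ne _
  have hT : Measurable fun z => x (k z) := (measurable_of_finite x).comp hkm
  have := Measure.isProbabilityMeasure_map (μ := m) hT.aemeasurable
  have htie : ∀ᵐ z ∂m, ∀ i j, x i ≠ x j → ‖x i - z‖ ^ 2 - w i ≠ ‖x j - z‖ ^ 2 - w j := by
    simp only [ae_all_iff]
    intro i j hij
    have : ∀ᵐ z ∂μ, ‖x i - z‖ ^ 2 - w i ≠ ‖x j - z‖ ^ 2 - w j := by
      rw [ae_iff]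
      simpa only [ne_eq, not_not] using addHaar_setOf_norm_sub_sq_eq μ hij (w i) (w j)
    exact hac this
  symm
  -- Both measures have mass one, so the lower bound on cell masses suffices.
  refine Measure.eq_of_le_of_isProbabilityMeasure (Measure.le_iff.2 fun B hB => ?_)
  rw [empiricalMeasure_apply x hB, Measure.map_apply hT hB]
  set A := Finset.univ.filter fun i => x i ∈ B
  have h1 := card_div_le_measureReal_of_forall_le hm hw A
  have h2 : ((A.card : ℝ≥0∞) / n) ≤
      m {z | ∃ i ∈ A, ∀ j, ‖x i - z‖ ^ 2 - w i ≤ ‖x j - z‖ ^ 2 - w j} := by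
    rw [← ENNReal.toReal_le_toReal (ENNReal.div_ne_top (by simp) (by simp [NeZero.ne n]))
      (measure_ne_top _ _)]
    simpa only [ENNReal.toReal_div, ENNReal.toReal_natCast, Measure.real] using h1
  refine h2.trans (measure_mono_ae ?_)
  filter_upwards [htie] with z hz
  rintro ⟨i, hi, h⟩
  have hx : x i = x (k z) := by
    by_contra hne
    exact hz i (k z) hne (le_antisymm (h _) (hk z i))
  have : x i ∈ B := (Finset.mem_filter.1 hi).2
  rw [hx] at this
  exact this

theorem edist_sq_eq_ofReal (a b : E) : edist a b ^ 2 = ENNReal.ofReal (‖a - b‖ ^ 2) := by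
  rw [edist_dist, dist_eq_norm, ← ENNReal.ofReal_pow (norm_nonneg _)]

/-- A map to a nearest point, in the weighted sense, is optimal for its image. -/
theorem isOptimalMap_nearest (hm : ∀ᵐ z ∂m, ‖z‖ ≤ r) {x : Fin n → E} (w : Fin n → ℝ)
    {k : E → Fin n} (hkm : Measurable k)
    (hk : ∀ z j, ‖x (k z) - z‖ ^ 2 - w (k z) ≤ ‖x j - z‖ ^ 2 - w j)
    (hmap : m.map (fun z => x (k z)) = empiricalMeasure x) :
    IsOptimalMap m (empiricalMeasure x) fun z => x (k z) := by
  classical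
  have hT : Measurable fun z => x (k z) := (measurable_of_finite x).comp hkm
  refine ⟨hT, hmap, le_antisymm (le_iInf₂ fun π hπ => ?_) ?_⟩
  swap
  · have := W2Sq_le_lintegral m measurable_id hT
    rw [hmap, Measure.map_id] at this
    simpa [edist_comm] using this
  have := isProbabilityMeasure_of_mem_transportPlans hπ
  -- the dual pair of potentials
  set φ : E → ℝ := laguerrePotential x w with hφ
  have hφc : Continuous φ := continuous_laguerrePotential_right x w
  have hφi : Integrable φ m := integrable_of_continuous hm hφc
  -- Among coincident points only the largest weight is active, hence the maximum over the fibre.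
  -- The value `0` off the range is never seen by the second marginal.
  set ψ : E → ℝ := fun y => if h : ∃ i, x i = y ∧ ∀ j, x j = y → w j ≤ w i then
    w h.choose else 0 with hψ
  have hψspec : ∀ i, (∀ j, x j = x i → w j ≤ w i) → ψ (x i) = w i := by
    intro i hi
    have h : ∃ i', x i' = x i ∧ ∀ j, x j = x i → w j ≤ w i' := ⟨i, rfl, hi⟩
    simp only [hψ, dif_pos h]
    exact le_antisymm (hi _ h.choose_spec.1) (h.choose_spec.2 _ rfl)
  have hψm : Measurable ψ := by
    refine (measurable_const (a := (0 : ℝ))).measurable_of_countable_ne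
      ((Set.finite_range x).subset ?_).countable
    intro y hy
    by_contra hyx
    refine hy (Eq.symm ?_)
    simp only [hψ]
    rw [dif_neg]
    rintro ⟨i, rfl, -⟩
    exact hyx ⟨i, rfl⟩
  have hψle : ∀ i z, φ z + ψ (x i) ≤ ‖z - x i‖ ^ 2 := by
    intro i z
    obtain ⟨i', hi', hmax⟩ := (Finset.univ.filter fun j => x j = x i).exists_max_image w
      ⟨i, by simp⟩
    have hxi : x i' = x i := (Finset.mem_filter.1 hi').2
    rw [← hxi, hψspec i' fun j hj => hmax j (by simp [hj, hxi]), norm_sub_rev]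
    linarith [laguerrePotential_le x w z i']
  have hψeq : ∀ z, ‖x (k z) - z‖ ^ 2 = φ z + ψ (x (k z)) := by
    intro z
    rw [hψspec (k z) fun j hj => by have := hk z j; rw [hj] at this; linarith]
    have := laguerrePotential_le x w z (k z)
    have := le_laguerrePotential (hk z)
    linarith
  have hψi : Integrable ψ (empiricalMeasure x) := by
    rw [empiricalMeasure_eq_map, integrable_map_measure hψm.aestronglyMeasurable
      (measurable_of_finite x).aemeasurable]
    exact Integrable.of_finite
  have h1 : ∫⁻ z, edist (x (k z)) z ^ 2 ∂m =
      ENNReal.ofReal (∫ z, φ z ∂m + ∫ y, ψ y ∂empiricalMeasure x) := by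
    have hψi' : Integrable (fun z => ψ (x (k z))) m := by
      rw [← hmap] at hψi
      exact hψi.comp_measurable hT
    simp only [edist_sq_eq_ofReal, hψeq]
    rw [← hmap, integral_map hT.aemeasurable hψm.aestronglyMeasurable, ← integral_add hφi hψi',
      ofReal_integral_eq_lintegral_ofReal (f := fun z => φ z + ψ (x (k z))) (hφi.add hψi')]
    exact Filter.Eventually.of_forall fun z => (sq_nonneg ‖x (k z) - z‖).trans_eq (hψeq z)
  have hφπ : Integrable (fun p : E × E => φ p.1) π := by
    rw [← hπ.1] at hφi
    exact hφi.comp_measurable measurable_fst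
  have hψπ : Integrable (fun p : E × E => ψ p.2) π := by
    rw [← hπ.2] at hψi
    exact hψi.comp_measurable measurable_snd
  have h2 : ∫ z, φ z ∂m + ∫ y, ψ y ∂empiricalMeasure x = ∫ p, (φ p.1 + ψ p.2) ∂π := by
    rw [integral_add hφπ hψπ, ← hπ.1, ← hπ.2,
      integral_map measurable_fst.aemeasurable hφc.aestronglyMeasurable,
      integral_map measurable_snd.aemeasurable hψm.aestronglyMeasurable]
  have h3 : ∀ᵐ p ∂π, p.2 ∈ Set.range x := by
    have := ae_map_empiricalMeasure_mem x
    rw [← hπ.2] at this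
    exact ae_of_ae_map (by fun_prop) this
  rw [h1, h2]
  have hint := hφπ.add hψπ
  -- The sum `φ + ψ` may be negative; its positive part is still below the nonnegative cost.
  calc ENNReal.ofReal (∫ p, (φ p.1 + ψ p.2) ∂π)
      ≤ ENNReal.ofReal (∫ p, max (φ p.1 + ψ p.2) 0 ∂π) :=
        ENNReal.ofReal_le_ofReal (integral_mono hint hint.pos_part fun p => le_max_left _ _)
    _ = ∫⁻ p, ENNReal.ofReal (max (φ p.1 + ψ p.2) 0) ∂π :=
        ofReal_integral_eq_lintegral_ofReal hint.pos_part
          (Filter.Eventually.of_forall fun p => le_max_right _ _)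
    _ ≤ ∫⁻ p, edist p.1 p.2 ^ 2 ∂π := by
        refine lintegral_mono_ae ?_
        filter_upwards [h3] with p hp
        obtain ⟨i, hi⟩ := hp
        rw [edist_sq_eq_ofReal]
        refine ENNReal.ofReal_le_ofReal (max_le ?_ (sq_nonneg _))
        rw [← hi]
        exact hψle i p.1

/-- Optimal maps to empirical measures exist and can be chosen measurably in the points. -/
theorem exists_measurable_isOptimalMap {μ : Measure E} [μ.IsAddHaarMeasure] (hac : m ≪ μ)
    (hm : ∀ᵐ z ∂m, ‖z‖ ≤ r) :
    ∃ T : (Fin n → E) → E → E, Measurable (Function.uncurry T) ∧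
      ∀ x, IsOptimalMap m (empiricalMeasure x) (T x) := by
  obtain ⟨w, hwm, hw⟩ := exists_measurable_semidiscreteDual_argmax (n := n) hm
  obtain ⟨s, hs, hmax⟩ := exists_measurable_argmax (X := ((Fin n → E) × (Fin n → ℝ)) × E)
    (U := Fin n) (F := fun p i => p.1.2 i - ‖p.1.1 i - p.2‖ ^ 2) (by
      rw [continuous_prod_of_discrete_right]
      intro i
      simp only [Function.uncurry]
      fun_prop)
  set k : (Fin n → E) → E → Fin n := fun x z => s ((x, w x), z) with hk
  have hkm : Measurable (Function.uncurry k) := hs.comp (by fun_prop)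
  have hev : Measurable fun p : (Fin n → E) × Fin n => p.1 p.2 :=
    measurable_from_prod_countable_left fun i => measurable_pi_apply i
  refine ⟨fun x z => x (k x z), hev.comp (measurable_fst.prodMk hkm), fun x => ?_⟩
  have hkx : Measurable (k x) := hkm.of_uncurry_left
  have hkle : ∀ z j, ‖x (k x z) - z‖ ^ 2 - w x (k x z) ≤ ‖x j - z‖ ^ 2 - w x j := fun z j => by
    have := hmax ((x, w x), z) j
    simp only at this
    simp only [hk]
    linarith
  exact isOptimalMap_nearest hm (w x) hkx hkle
    (map_nearest_eq_empiricalMeasure hac hm (hw x) hkx hkle)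

end OptimalMaps

/-! ### Bounds, variance identity and the averaged inequality -/

section Expectation

variable {E : Type*} [NormedAddCommGroup E] [InnerProductSpace ℝ E] {n : ℕ} [NeZero n]
  [MeasurableSpace E] [FiniteDimensional ℝ E] [BorelSpace E]
  {m : Measure E} [IsProbabilityMeasure m] {r : ℝ}
  {Ω : Type*} [MeasurableSpace Ω] {P : Measure Ω} [IsProbabilityMeasure P]

theorem edist_sq_le_of_norm_le {a b : E} (ha : ‖a‖ ≤ r) (hb : ‖b‖ ≤ r) :
    edist a b ^ 2 ≤ ENNReal.ofReal ((2 * r) ^ 2) := by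
  rw [edist_sq_eq_ofReal]
  refine ENNReal.ofReal_le_ofReal (pow_le_pow_left₀ (norm_nonneg _) ?_ 2)
  linarith [norm_sub_le a b]

theorem W2Sq_empiricalMeasure_le {x y : Fin n → E} (hx : ∀ i, ‖x i‖ ≤ r) (hy : ∀ i, ‖y i‖ ≤ r) :
    W2Sq (empiricalMeasure x) (empiricalMeasure y) ≤ ENNReal.ofReal ((2 * r) ^ 2) := by
  rw [empiricalMeasure_eq_map x, empiricalMeasure_eq_map y]
  refine (W2Sq_le_lintegral _ (measurable_of_finite x) (measurable_of_finite y)).trans ?_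
  refine (lintegral_mono fun i => edist_sq_le_of_norm_le (hx i) (hy i)).trans ?_
  simp

theorem W2Sq_empiricalMeasure_ne_top (x y : Fin n → E) :
    W2Sq (empiricalMeasure x) (empiricalMeasure y) ≠ ∞ := by
  obtain ⟨i, hi⟩ := Finite.exists_max fun i => ‖x i‖
  obtain ⟨j, hj⟩ := Finite.exists_max fun i => ‖y i‖
  exact ((W2Sq_empiricalMeasure_le (fun k => (hi k).trans (le_max_left _ ‖y j‖))
    fun k => (hj k).trans (le_max_right _ _)).trans_lt ENNReal.ofReal_lt_top).ne

theorem W2Sq_le_of_isOptimalMap (hm : ∀ᵐ z ∂m, ‖z‖ ≤ r) {x : Fin n → E}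
    (hx : ∀ i, ‖x i‖ ≤ r) {T : E → E} (hT : IsOptimalMap m (empiricalMeasure x) T) :
    W2Sq m (empiricalMeasure x) ≤ ENNReal.ofReal ((2 * r) ^ 2) := by
  rw [← hT.2.2]
  have hmem : ∀ᵐ z ∂m, T z ∈ Set.range x := by
    have := ae_map_empiricalMeasure_mem x
    rw [← hT.2.1] at this
    exact ae_of_ae_map hT.1.aemeasurable this
  calc ∫⁻ z, edist (T z) z ^ 2 ∂m ≤ ∫⁻ _, ENNReal.ofReal ((2 * r) ^ 2) ∂m := by
        refine lintegral_mono_ae ?_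
        filter_upwards [hm, hmem] with z hz hTz
        obtain ⟨i, hi⟩ := hTz
        exact edist_sq_le_of_norm_le (hi ▸ hx i) hz
    _ = _ := by simp

theorem W2Sq_ne_top_of_isOptimalMap (hm : ∀ᵐ z ∂m, ‖z‖ ≤ r) {x : Fin n → E} {T : E → E}
    (hT : IsOptimalMap m (empiricalMeasure x) T) : W2Sq m (empiricalMeasure x) ≠ ∞ := by
  obtain ⟨i, hi⟩ := Finite.exists_max fun i => ‖x i‖
  exact ((W2Sq_le_of_isOptimalMap (r := max r ‖x i‖) (hm.mono fun z hz => hz.trans (le_max_left _ _))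
    (fun k => (hi k).trans (le_max_right _ _)) hT).trans_lt ENNReal.ofReal_lt_top).ne

theorem integral_norm_sub_sq {f : Ω → E} (hf : Integrable f P)
    (hf2 : Integrable (fun ω => ‖f ω‖ ^ 2) P) (v : E) :
    Integrable (fun ω => ‖v - f ω‖ ^ 2) P ∧
    ∫ ω, ‖v - f ω‖ ^ 2 ∂P =
      ‖v‖ ^ 2 - 2 * inner ℝ v (∫ ω, f ω ∂P) + ∫ ω, ‖f ω‖ ^ 2 ∂P := by
  have hin : Integrable (fun ω => 2 * inner ℝ v (f ω)) P := (hf.const_inner v).const_mul 2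
  have hi1 : Integrable (fun ω => ‖v‖ ^ 2 - 2 * inner ℝ v (f ω)) P := (integrable_const _).sub hin
  simp only [norm_sub_sq_real v]
  refine ⟨hi1.add hf2, ?_⟩
  rw [integral_add hi1 hf2, integral_sub (integrable_const _) hin,
    integral_const_mul, integral_inner hf v]
  simp

theorem norm_integral_sq_le {f : Ω → E} (hf : Integrable f P)
    (hf2 : Integrable (fun ω => ‖f ω‖ ^ 2) P) :
    ‖∫ ω, f ω ∂P‖ ^ 2 ≤ ∫ ω, ‖f ω‖ ^ 2 ∂P := by
  have h := (integral_norm_sub_sq hf hf2 (∫ ω, f ω ∂P)).2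
  rw [real_inner_self_eq_norm_sq] at h
  have : 0 ≤ ∫ ω, ‖(∫ ω, f ω ∂P) - f ω‖ ^ 2 ∂P := integral_nonneg fun ω => sq_nonneg _
  linarith

/-- The mean squared distance of two independent copies is twice the variance. -/
theorem lintegral_lintegral_edist_sq {f : Ω → E} (hf : Integrable f P)
    (hf2 : Integrable (fun ω => ‖f ω‖ ^ 2) P) :
    ∫⁻ ω, ∫⁻ ω', edist (f ω) (f ω') ^ 2 ∂P ∂P =
      ENNReal.ofReal (2 * ∫ ω, ‖f ω‖ ^ 2 ∂P - 2 * ‖∫ ω, f ω ∂P‖ ^ 2) := by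
  have h1 : ∀ v : E, ∫⁻ ω', edist v (f ω') ^ 2 ∂P = ENNReal.ofReal (∫ ω, ‖v - f ω‖ ^ 2 ∂P) := by
    intro v
    simp only [edist_sq_eq_ofReal]
    exact (ofReal_integral_eq_lintegral_ofReal (integral_norm_sub_sq hf hf2 v).1
      (Filter.Eventually.of_forall fun ω => sq_nonneg _)).symm
  set V := ∫ ω, f ω ∂P with hV
  have hinV : Integrable (fun ω => 2 * inner ℝ (f ω) V) P := (hf.inner_const V).const_mul 2
  have hi2 : Integrable (fun ω => ‖f ω‖ ^ 2 - 2 * inner ℝ (f ω) V) P := hf2.sub hinV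
  have hV2 : ∫ ω, inner ℝ (f ω) V ∂P = ‖V‖ ^ 2 := by
    rw [← real_inner_self_eq_norm_sq, hV, ← integral_inner hf]
    simp only [real_inner_comm]
  have heq : ∀ v, ∫ ω, ‖v - f ω‖ ^ 2 ∂P =
      ‖v‖ ^ 2 - 2 * inner ℝ v V + ∫ ω, ‖f ω‖ ^ 2 ∂P := fun v => (integral_norm_sub_sq hf hf2 v).2
  simp only [h1]
  rw [← ofReal_integral_eq_lintegral_ofReal]
  · simp only [heq]
    rw [integral_add hi2 (integrable_const _), integral_sub hf2 hinV, integral_const_mul, hV2]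
    simp only [integral_const, probReal_univ, smul_eq_mul, one_mul]
    congr 1
    ring
  · simp only [heq]
    exact hi2.add (integrable_const _)
  · exact Filter.Eventually.of_forall fun ω => integral_nonneg fun ω' => sq_nonneg _

/-- The joint law of two independent i.i.d. samples is that of two independent copies of the
first one. -/
theorem map_prodMk_eq_map_prod {α : Type*} [MeasurableSpace α] {m : Measure α}
    [IsProbabilityMeasure m] {X Y : Fin n → Ω → α}
    (hXm : ∀ i, Measurable (X i)) (hYm : ∀ i, Measurable (Y i))
    (hXlaw : ∀ i, P.map (X i) = m) (hYlaw : ∀ i, P.map (Y i) = m)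
    (hindep : iIndepFun (Sum.elim X Y) P) :
    P.map (fun ω => (fun i => X i ω, fun i => Y i ω)) =
      (P.prod P).map (fun p => (fun i => X i p.1, fun i => X i p.2)) := by
  have hZ : ∀ k, Measurable (Sum.elim X Y k) := by rintro (i | i) <;> simp [hXm, hYm]
  have hlaw : ∀ k, P.map (Sum.elim X Y k) = m := by rintro (i | i) <;> simp [hXlaw, hYlaw]
  have h1 := (iIndepFun_iff_map_fun_eq_pi_map fun k => (hZ k).aemeasurable).1 hindep
  simp only [hlaw] at h1
  have h2 : P.map (fun ω => (fun i => X i ω, fun i => Y i ω)) =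
      (Measure.pi fun _ : Fin n => m).prod (Measure.pi fun _ : Fin n => m) := by
    rw [← (measurePreserving_sumPiEquivProdPi fun _ : Fin n ⊕ Fin n => m).map_eq, ← h1,
      Measure.map_map (MeasurableEquiv.measurable _) (measurable_pi_lambda _ hZ)]
    rfl
  have hXp : Measurable fun ω i => X i ω := measurable_pi_lambda _ hXm
  have hYp : Measurable fun ω i => Y i ω := measurable_pi_lambda _ hYm
  have h3 : P.map (fun ω i => X i ω) = Measure.pi fun _ : Fin n => m := by
    have := congrArg (Measure.map Prod.fst) h2
    rw [Measure.map_map measurable_fst (hXp.prodMk hYp), Measure.map_fst_prod] at this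
    simpa only [measure_univ, one_smul] using! this
  rw [h2, ← h3, Measure.map_prod_map _ _ hXp hXp]
  rfl

theorem ae_forall_norm_le_of_map_eq (hm : ∀ᵐ z ∂m, ‖z‖ ≤ r) {X : Fin n → Ω → E}
    (hXm : ∀ i, Measurable (X i)) (hXlaw : ∀ i, P.map (X i) = m) :
    ∀ᵐ ω ∂P, ∀ i, ‖X i ω‖ ≤ r := by
  rw [ae_all_iff]
  intro i
  rw [← hXlaw i] at hm
  exact ae_of_ae_map (hXm i).aemeasurable hm

theorem W2Sq_le_lintegral_edist_maps {x y : Fin n → E} {S T : E → E}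
    (hS : IsOptimalMap m (empiricalMeasure x) S) (hT : IsOptimalMap m (empiricalMeasure y) T) :
    W2Sq (empiricalMeasure x) (empiricalMeasure y) ≤ ∫⁻ z, edist (S z) (T z) ^ 2 ∂m := by
  rw [← hS.2.1, ← hT.2.1]
  exact W2Sq_le_lintegral m hS.1 hT.1

/-- The matching inequality for a jointly measurable family of optimal maps. -/
theorem integral_W2Sq_le_of_measurable (hm : ∀ᵐ z ∂m, ‖z‖ ≤ r) {X Y : Fin n → Ω → E}
    (hXm : ∀ i, Measurable (X i)) (hYm : ∀ i, Measurable (Y i))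
    (hXlaw : ∀ i, P.map (X i) = m) (hYlaw : ∀ i, P.map (Y i) = m)
    (hindep : iIndepFun (Sum.elim X Y) P)
    {T : Ω → E → E} (hTm : Measurable (Function.uncurry T))
    (hT : ∀ᵐ ω ∂P, IsOptimalMap m (empiricalMeasure fun i => X i ω) (T ω)) :
    (∀ᵐ z ∂m, Integrable (fun ω => T ω z - z) P) ∧
    Integrable (fun z => ‖∫ ω, (T ω z - z) ∂P‖ ^ 2) m ∧
    ∫ ω, (W2Sq (empiricalMeasure fun i => X i ω) (empiricalMeasure fun i => Y i ω)).toReal ∂P ≤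
      2 * ∫ ω, (W2Sq m (empiricalMeasure fun i => X i ω)).toReal ∂P
        - 2 * ∫ z, ‖∫ ω, (T ω z - z) ∂P‖ ^ 2 ∂m := by
  have hXp : Measurable fun ω i => X i ω := measurable_pi_lambda _ hXm
  have hYp : Measurable fun ω i => Y i ω := measurable_pi_lambda _ hYm
  have hTm1 : ∀ z, Measurable fun ω => T ω z := fun z => hTm.of_uncurry_right
  have hUm : Measurable fun p : Ω × E => T p.1 p.2 - p.2 := by
    have : Measurable fun p : Ω × E => T p.1 p.2 := hTm
    exact this.sub measurable_snd
  have hae : ∀ᵐ ω ∂P, ∀ᵐ z ∂m, ‖T ω z - z‖ ≤ 2 * r := by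
    filter_upwards [hT, ae_forall_norm_le_of_map_eq hm hXm hXlaw] with ω hω hX
    have hmem : ∀ᵐ z ∂m, T ω z ∈ Set.range fun i => X i ω := by
      have := ae_map_empiricalMeasure_mem fun i => X i ω
      rw [← hω.2.1] at this
      exact ae_of_ae_map hω.1.aemeasurable this
    filter_upwards [hm, hmem] with z hz ⟨i, hi⟩
    have : ‖T ω z‖ ≤ r := by rw [← hi]; exact hX i
    linarith [norm_sub_le (T ω z) z]
  have hms : MeasurableSet {p : Ω × E | ‖T p.1 p.2 - p.2‖ ≤ 2 * r} :=
    measurableSet_le hUm.norm measurable_const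
  have hprod : ∀ᵐ p ∂P.prod m, ‖T p.1 p.2 - p.2‖ ≤ 2 * r :=
    (Measure.ae_prod_iff_ae_ae hms).2 hae
  have hae' : ∀ᵐ z ∂m, ∀ᵐ ω ∂P, ‖T ω z - z‖ ≤ 2 * r := (Measure.ae_ae_comm hms).1 hae
  have hsq : ∀ {v : E}, ‖v‖ ≤ 2 * r → ‖‖v‖ ^ 2‖ ≤ (2 * r) ^ 2 := fun {v} hv => by
    rw [norm_pow, norm_norm]
    exact pow_le_pow_left₀ (norm_nonneg v) hv 2
  have hint : ∀ᵐ z ∂m, Integrable (fun ω => T ω z - z) P := by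
    filter_upwards [hae'] with z hz
    exact Integrable.of_bound ((hTm1 z).sub_const z).aestronglyMeasurable _ hz
  have hint2 : ∀ᵐ z ∂m, Integrable (fun ω => ‖T ω z - z‖ ^ 2) P := by
    filter_upwards [hae'] with z hz
    exact Integrable.of_bound (((hTm1 z).sub_const z).norm.pow_const 2).aestronglyMeasurable _
      (hz.mono fun ω hω => hsq hω)
  have hprod2 : Integrable (fun p : Ω × E => ‖T p.1 p.2 - p.2‖ ^ 2) (P.prod m) :=
    Integrable.of_bound (hUm.norm.pow_const 2).aestronglyMeasurable _
      (hprod.mono fun ω hω => hsq hω)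
  have hVm : StronglyMeasurable fun z => ∫ ω, (T ω z - z) ∂P := by
    have : StronglyMeasurable fun p : E × Ω => T p.2 p.1 - p.1 :=
      (hUm.comp measurable_swap).stronglyMeasurable
    exact this.integral_prod_right'
  have hV : Integrable (fun z => ‖∫ ω, (T ω z - z) ∂P‖ ^ 2) m := by
    refine Integrable.of_bound (hVm.norm.pow 2).aestronglyMeasurable ((2 * r) ^ 2) ?_
    filter_upwards [hae'] with z hz
    refine hsq ((norm_integral_le_of_norm_le_const hz).trans_eq ?_)
    simp
  refine ⟨hint, hV, ?_⟩
  have ha : Integrable (fun z => ∫ ω, ‖T ω z - z‖ ^ 2 ∂P) m := hprod2.integral_prod_right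
  have hcost : ∫ z, ∫ ω, ‖T ω z - z‖ ^ 2 ∂P ∂m =
      ∫ ω, (W2Sq m (empiricalMeasure fun i => X i ω)).toReal ∂P := by
    rw [← integral_integral_swap (f := fun ω z => ‖T ω z - z‖ ^ 2) hprod2]
    refine integral_congr_ae ?_
    filter_upwards [hT] with ω hω
    rw [← hω.2.2]
    simp only [edist_sq_eq_ofReal]
    rw [integral_eq_lintegral_of_nonneg_ae (Filter.Eventually.of_forall fun z => sq_nonneg _)]
    exact ((hω.1.sub measurable_id).norm.pow_const 2).aestronglyMeasurable
  -- Subtracting the common point `z` does not change distances, so the variance identity applies to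
  -- displacements.
  have hvar : ∀ z, Integrable (fun ω => T ω z - z) P → Integrable (fun ω => ‖T ω z - z‖ ^ 2) P →
      ∫⁻ ω, ∫⁻ ω', edist (T ω z) (T ω' z) ^ 2 ∂P ∂P = ENNReal.ofReal
        (2 * ∫ ω, ‖T ω z - z‖ ^ 2 ∂P - 2 * ‖∫ ω, (T ω z - z) ∂P‖ ^ 2) := by
    intro z h1 h2
    rw [← lintegral_lintegral_edist_sq h1 h2]
    simp only [edist_sub_right]
  have hnn : ∀ᵐ z ∂m, 0 ≤ 2 * ∫ ω, ‖T ω z - z‖ ^ 2 ∂P - 2 * ‖∫ ω, (T ω z - z) ∂P‖ ^ 2 := by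
    filter_upwards [hint, hint2] with z h1 h2
    linarith [norm_integral_sq_le h1 h2]
  have hG : Measurable fun q : (Ω × Ω) × E => edist (T q.1.1 q.2) (T q.1.2 q.2) ^ 2 := by
    have h1 : Measurable fun q : (Ω × Ω) × E => T q.1.1 q.2 :=
      hTm.comp ((measurable_fst.comp measurable_fst).prodMk measurable_snd)
    have h2 : Measurable fun q : (Ω × Ω) × E => T q.1.2 q.2 :=
      hTm.comp ((measurable_snd.comp measurable_fst).prodMk measurable_snd)
    exact (h1.edist h2).pow_const 2
  have hW : Measurable fun p : (Fin n → E) × (Fin n → E) =>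
    W2Sq (empiricalMeasure p.1) (empiricalMeasure p.2) := measurable_W2Sq_empiricalMeasure
  -- In `ℝ≥0∞`, Tonelli needs only measurability.
  have hmain : ∫⁻ ω, W2Sq (empiricalMeasure fun i => X i ω) (empiricalMeasure fun i => Y i ω) ∂P ≤
      ENNReal.ofReal (∫ z, (2 * ∫ ω, ‖T ω z - z‖ ^ 2 ∂P - 2 * ‖∫ ω, (T ω z - z) ∂P‖ ^ 2) ∂m) := by
    calc ∫⁻ ω, W2Sq (empiricalMeasure fun i => X i ω) (empiricalMeasure fun i => Y i ω) ∂P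
        = ∫⁻ p, W2Sq (empiricalMeasure p.1) (empiricalMeasure p.2)
            ∂(P.map fun ω => (fun i => X i ω, fun i => Y i ω)) := by
          rw [lintegral_map hW (hXp.prodMk hYp)]
      _ = ∫⁻ p, W2Sq (empiricalMeasure fun i => X i p.1) (empiricalMeasure fun i => X i p.2)
            ∂(P.prod P) := by
          rw [map_prodMk_eq_map_prod hXm hYm hXlaw hYlaw hindep, lintegral_map hW]
          exact (hXp.comp measurable_fst).prodMk (hXp.comp measurable_snd)
      _ ≤ ∫⁻ p, ∫⁻ z, edist (T p.1 z) (T p.2 z) ^ 2 ∂m ∂(P.prod P) := by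
          refine lintegral_mono_ae ?_
          filter_upwards [Measure.quasiMeasurePreserving_fst.ae hT,
            Measure.quasiMeasurePreserving_snd.ae hT] with p h1 h2
          exact W2Sq_le_lintegral_edist_maps h1 h2
      _ = ∫⁻ z, ∫⁻ p, edist (T p.1 z) (T p.2 z) ^ 2 ∂(P.prod P) ∂m :=
          lintegral_lintegral_swap hG.aemeasurable
      _ = ∫⁻ z, ∫⁻ ω, ∫⁻ ω', edist (T ω z) (T ω' z) ^ 2 ∂P ∂P ∂m := by
          refine lintegral_congr fun z => lintegral_prod _ ?_
          exact (((hTm1 z).comp measurable_fst).edist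
            ((hTm1 z).comp measurable_snd)).pow_const 2 |>.aemeasurable
      _ = ∫⁻ z, ENNReal.ofReal
            (2 * ∫ ω, ‖T ω z - z‖ ^ 2 ∂P - 2 * ‖∫ ω, (T ω z - z) ∂P‖ ^ 2) ∂m := by
          refine lintegral_congr_ae ?_
          filter_upwards [hint, hint2] with z h1 h2 using hvar z h1 h2
      _ = _ := (ofReal_integral_eq_lintegral_ofReal
          ((ha.const_mul 2).sub (hV.const_mul 2)) hnn).symm
  rw [integral_toReal, ← hcost]
  · refine (ENNReal.toReal_mono ENNReal.ofReal_ne_top hmain).trans_eq ?_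
    rw [ENNReal.toReal_ofReal (integral_nonneg_of_ae hnn),
      integral_sub (ha.const_mul 2) (hV.const_mul 2), integral_const_mul, integral_const_mul]
  · exact (hW.comp (hXp.prodMk hYp)).aemeasurable
  · exact Filter.Eventually.of_forall fun ω => (W2Sq_empiricalMeasure_ne_top _ _).lt_top

end Expectation

/-! ### The main theorem -/

theorem mainTheorem4 {d n : ℕ} (hn : 1 ≤ n)
    (D : Set (EuclideanSpace ℝ (Fin d))) (hDm : MeasurableSet D) (hDb : Bornology.IsBounded D)
    (m : Measure (EuclideanSpace ℝ (Fin d))) [IsProbabilityMeasure m]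
    (hmD : m Dᶜ = 0) (hmac : m ≪ volume)
    {Ω : Type*} [MeasurableSpace Ω] (P : Measure Ω) [IsProbabilityMeasure P]
    (X Y : Fin n → Ω → EuclideanSpace ℝ (Fin d))
    (hXm : ∀ i, Measurable (X i)) (hYm : ∀ i, Measurable (Y i))
    (hXlaw : ∀ i, P.map (X i) = m) (hYlaw : ∀ i, P.map (Y i) = m)
    (hindep : iIndepFun (Sum.elim X Y) P) :
    -- the two expected squared distances are well defined and finite
    (∀ ω, W2Sq (empiricalMeasure fun i => X i ω) (empiricalMeasure fun i => Y i ω) ≠ ∞) ∧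
    (∀ ω, W2Sq (empiricalMeasure fun i => X i ω) m ≠ ∞) ∧
    Integrable (fun ω =>
      (W2Sq (empiricalMeasure fun i => X i ω) (empiricalMeasure fun i => Y i ω)).toReal) P ∧
    Integrable (fun ω => (W2Sq (empiricalMeasure fun i => X i ω) m).toReal) P ∧
    -- the optimal maps from `m` to the empirical measures exist and depend measurably on `ω`
    (∃ T : Ω → EuclideanSpace ℝ (Fin d) → EuclideanSpace ℝ (Fin d),
      Measurable (Function.uncurry T) ∧
      ∀ ω, IsOptimalMap m (empiricalMeasure fun i => X i ω) (T ω)) ∧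
    -- the inequality, for every measurable version of the family of optimal maps
    (∀ T : Ω → EuclideanSpace ℝ (Fin d) → EuclideanSpace ℝ (Fin d),
      AEMeasurable (Function.uncurry T) (P.prod m) →
      (∀ᵐ ω ∂P, IsOptimalMap m (empiricalMeasure fun i => X i ω) (T ω)) →
      (∀ᵐ x ∂m, Integrable (fun ω => T ω x - x) P) ∧
      IntegrableOn (fun x => ‖∫ ω, (T ω x - x) ∂P‖ ^ 2) D m ∧
      ∫ ω, (W2Sq (empiricalMeasure fun i => X i ω)
          (empiricalMeasure fun i => Y i ω)).toReal ∂P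
        ≤ 2 * ∫ ω, (W2Sq (empiricalMeasure fun i => X i ω) m).toReal ∂P
          - 2 * ∫ x in D, ‖∫ ω, (T ω x - x) ∂P‖ ^ 2 ∂m) := by
  have : NeZero n := ⟨by omega⟩
  obtain ⟨r, hr⟩ := hDb.exists_norm_le
  have hmD' : ∀ᵐ z ∂m, z ∈ D := hmD
  have hm : ∀ᵐ z ∂m, ‖z‖ ≤ r := hmD'.mono fun z hz => hr z hz
  have hXp : Measurable fun ω i => X i ω := measurable_pi_lambda _ hXm
  have hYp : Measurable fun ω i => Y i ω := measurable_pi_lambda _ hYm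
  obtain ⟨S, hSm, hS⟩ := exists_measurable_isOptimalMap (n := n) hmac hm
  have hfin : ∀ x : Fin n → EuclideanSpace ℝ (Fin d), W2Sq m (empiricalMeasure x) ≠ ∞ :=
    fun x => W2Sq_ne_top_of_isOptimalMap hm (hS x)
  have hrestrict : m.restrict D = m := Measure.restrict_eq_self_of_ae_mem hmD'
  have hXr := ae_forall_norm_le_of_map_eq hm hXm hXlaw
  have hYr := ae_forall_norm_le_of_map_eq hm hYm hYlaw
  have hbound : ∀ {a : ℝ≥0∞}, a ≤ ENNReal.ofReal ((2 * r) ^ 2) → ‖a.toReal‖ ≤ (2 * r) ^ 2 := by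
    intro a ha
    rw [Real.norm_of_nonneg ENNReal.toReal_nonneg]
    exact ENNReal.toReal_le_of_le_ofReal (sq_nonneg _) ha
  simp only [W2Sq_comm _ m]
  refine ⟨fun ω => W2Sq_empiricalMeasure_ne_top _ _, fun ω => hfin _, ?_, ?_, ?_, ?_⟩
  · refine Integrable.of_bound (measurable_W2Sq_empiricalMeasure.comp
      (hXp.prodMk hYp)).ennreal_toReal.aestronglyMeasurable ((2 * r) ^ 2) ?_
    filter_upwards [hXr, hYr] with ω h1 h2
    exact hbound (W2Sq_empiricalMeasure_le h1 h2)
  · have hcost : Measurable fun x : Fin n → EuclideanSpace ℝ (Fin d) =>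
        W2Sq m (empiricalMeasure x) := by
      -- The measurable selection `S` turns the distance to `m` into a parametric integral, hence
      -- measurable in `x`.
      simp only [← (hS _).2.2]
      exact Measurable.lintegral_prod_right' (f := fun p => edist (S p.1 p.2) p.2 ^ 2)
        ((hSm.edist measurable_snd).pow_const 2)
    refine Integrable.of_bound (hcost.comp hXp).ennreal_toReal.aestronglyMeasurable
      ((2 * r) ^ 2) ?_
    filter_upwards [hXr] with ω h1
    exact hbound (W2Sq_le_of_isOptimalMap hm h1 (hS _))
  · exact ⟨fun ω => S fun i => X i ω,
      hSm.comp ((hXp.comp measurable_fst).prodMk measurable_snd), fun ω => hS _⟩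
  · intro T hT hopt
    -- A jointly measurable version of `T`. Agreement on almost every `ω`-slice transfers
    -- optimality; agreement on almost every `z`-slice transfers the expectations.
    set T' : Ω → EuclideanSpace ℝ (Fin d) → EuclideanSpace ℝ (Fin d) :=
      fun ω z => hT.mk _ (ω, z) with hT'
    have hT'm : Measurable (Function.uncurry T') := hT.measurable_mk
    have heq : ∀ᵐ p ∂P.prod m, T p.1 p.2 = T' p.1 p.2 := hT.ae_eq_mk
    have heq1 : ∀ᵐ ω ∂P, ∀ᵐ z ∂m, T ω z = T' ω z := Measure.ae_ae_of_ae_prod heq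
    have heq2 : ∀ᵐ z ∂m, ∀ᵐ ω ∂P, T ω z = T' ω z := by
      refine Measure.ae_ae_of_ae_prod (p := fun q => T q.2 q.1 = T' q.2 q.1) ?_
      exact Measure.measurePreserving_swap.quasiMeasurePreserving.ae heq
    have hopt' : ∀ᵐ ω ∂P, IsOptimalMap m (empiricalMeasure fun i => X i ω) (T' ω) := by
      filter_upwards [heq1, hopt] with ω h1 h2
      refine ⟨hT'm.of_uncurry_left, ?_, ?_⟩
      · rw [← h2.2.1]
        exact (Measure.map_congr h1).symm
      · rw [← h2.2.2]
        refine lintegral_congr_ae ?_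
        filter_upwards [h1] with z hz
        rw [hz]
    obtain ⟨h1, h2, h3⟩ := integral_W2Sq_le_of_measurable hm hXm hYm hXlaw hYlaw hindep hT'm hopt'
    have heqV : (fun z => ‖∫ ω, (T ω z - z) ∂P‖ ^ 2) =ᵐ[m]
        fun z => ‖∫ ω, (T' ω z - z) ∂P‖ ^ 2 := by
      filter_upwards [heq2] with z hz
      have : ∫ ω, (T ω z - z) ∂P = ∫ ω, (T' ω z - z) ∂P :=
        integral_congr_ae (hz.mono fun ω hω => by simp only [hω])
      rw [this]
    rw [IntegrableOn, hrestrict, integral_congr_ae heqV]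
    refine ⟨?_, h2.congr heqV.symm, h3⟩
    filter_upwards [h1, heq2] with z hz1 hz2
    exact hz1.congr (hz2.mono fun ω hω => by simp only [hω])
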